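/- Let $n \in \{1,2,3,\dots\}$ and let $\mathcal{PO}_n$ be the monoid, under composition of partial maps, of all order-preserving partial transformations of $\{1,\dots,n\}$, i.e. of all partial maps $\alpha$ from $\{1,\dots,n\}$ to itself such that $i\alpha \le j\alpha$ whenever $i \le j$ lie in the domain of $\alpha$. Maps act on the right, so that $\alpha\beta$ means first $\alpha$, then $\beta$. Let $J_{n-1}$ be the set of all partial transformations $\alpha$ of $\{1,\dots,n\}$ of rank $|\operatorname{im}(\alpha)| = n-1$, and for distinct $i,j \in \{1,\dots,n\}$ put $$L_i = \{\alpha \in J_{n-1} : i \notin \operatorname{im}(\alpha)\},\qquad R_i = \{\alpha \in J_{n-1} : i \notin \operatorname{dom}(\alpha)\},\qquad R_{\{i,j\}} = \{\alpha \in J_{n-1} : i,j\in\operatorname{dom}(\alpha),\ i\alpha = j\alpha\}.$$ A maximal subsemigroup of a semigroup $S$ is a proper subsemigroup that is not contained in any other proper subsemigroup. A maximal subsemigroup $M$ of a finite monoid $S$ arises from a Green's $\mathscr{J}$-class $J$ of $S$ if $S \setminus M \subseteq J$; it is then of type (M1) if $M\cap J=\varnothing$, of type (M2) if $M\cap J$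 is a union of both $\mathscr{L}$-classes and $\mathscr{R}$-classes of $J$ (at least one of each), and of type (M4) if $M \cap J$ is a non-empty union of $\mathscr{R}$-classes of $J$. **Theorem.** Let $n \ge 2$. The maximal subsemigroups of $\mathcal{PO}_n$ are exactly the following sets: (a) $\mathcal{PO}_n \setminus \{\operatorname{id}_n\}$, which arises from $\{\operatorname{id}_n\}$ and is of type (M1); (b) the union of $\mathcal{PO}_n \setminus J_{n-1}$ and all the sets $L_i \cap \mathcal{PO}_n$ with $i \in A$, $R_i \cap \mathcal{PO}_n$ with $i \notin A$, and $R_{\{i,i+1\}} \cap \mathcal{PO}_n$ with $1\le i\le n-1$ and $i, i+1 \notin A$, where $A$ is any non-empty proper subset of $\{1,\dots,n\}$; these arise from $J_{n-1}\cap\mathcal{PO}_n$ and are of type (M2); (c) $\mathcal{PO}_n \setminus R$, where $R$ is any Green's $\mathscr{R}$-class of $\mathcal{PO}_n$ contained in $J_{n-1}\cap\mathcal{PO}_n$; these arise from $J_{n-1}\cap\mathcal{PO}_n$ and are of type (M4). The monoid $\mathcal{PO}_1$ is the monoid of all partial transformations of $\{1\}$; it is a semilattice (a commutative semigroup of idempotents)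 of order $2$, and its maximal subsemigroups are its singleton subsets. For every $n \ge 1$, $\mathcal{PO}_n$ has exactly $2^n + 2n - 2$ maximal subsemigroups. -/

import Mathlib

open Set

/-! ### Maximal subsemigroups and Green's relations -/

section Semigroups

variable {S : Type*}

/-- `M` is a maximal subsemigroup of `S`: a proper subsemigroup of `S` that is not contained in
any other proper subsemigroup of `S`. -/
def IsMaximalSubsemigroup [Mul S] (M : Set S) : Prop :=
  ∃ N : Subsemigroup S, (N : Set S) = M ∧ IsCoatom N

/-- The principal left ideal `Sx ∪ {x}`. -/
def principalLeftIdeal [Mul S] (x : S) : Set S :=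
  {y | ∃ s, y = s * x} ∪ {x}

/-- The principal right ideal `xS ∪ {x}`. -/
def principalRightIdeal [Mul S] (x : S) : Set S :=
  {y | ∃ s, y = x * s} ∪ {x}

/-- The principal (two-sided) ideal `SxS ∪ Sx ∪ xS ∪ {x}`. -/
def principalIdeal [Mul S] (x : S) : Set S :=
  {y | ∃ s t, y = s * x * t} ∪ {y | ∃ s, y = s * x} ∪ {y | ∃ s, y = x * s} ∪ {x}

/-- `K` is a class of Green's `L`-relation on `S`. -/
def IsGreenLClass [Mul S] (K : Set S) : Prop :=
  ∃ x, K = {y | principalLeftIdeal y = principalLeftIdeal x}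

/-- `K` is a class of Green's `R`-relation on `S`. -/
def IsGreenRClass [Mul S] (K : Set S) : Prop :=
  ∃ x, K = {y | principalRightIdeal y = principalRightIdeal x}

/-- `K` is a class of Green's `J`-relation on `S`. -/
def IsGreenJClass [Mul S] (K : Set S) : Prop :=
  ∃ x, K = {y | principalIdeal y = principalIdeal x}

/-- `M` is a maximal subsemigroup of `S` arising from the `J`-class `J` of `S`. -/
def MaximalArisesFrom [Mul S] (J M : Set S) : Prop :=
  IsGreenJClass J ∧ IsMaximalSubsemigroup M ∧ Mᶜ ⊆ J

/-- Type (M1): the maximal subsemigroup `M` arises from `J` and `M ∩ J` is empty. -/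
def MaximalOfTypeM1 [Mul S] (J M : Set S) : Prop :=
  MaximalArisesFrom J M ∧ M ∩ J = ∅

/-- Type (M2): the maximal subsemigroup `M` arises from `J` and `M ∩ J` is a union of both
`L`-classes and `R`-classes of `J`, with at least one class of each kind. -/
def MaximalOfTypeM2 [Mul S] (J M : Set S) : Prop :=
  MaximalArisesFrom J M ∧
    ∃ 𝓛 𝓡 : Set (Set S), 𝓛.Nonempty ∧ 𝓡.Nonempty ∧
      (∀ K ∈ 𝓛, IsGreenLClass K ∧ K ⊆ J) ∧ (∀ K ∈ 𝓡, IsGreenRClass K ∧ K ⊆ J) ∧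
      M ∩ J = ⋃₀ 𝓛 ∪ ⋃₀ 𝓡

/-- Type (M4): the maximal subsemigroup `M` arises from `J` and `M ∩ J` is a non-empty union of
`R`-classes of `J`. -/
def MaximalOfTypeM4 [Mul S] (J M : Set S) : Prop :=
  MaximalArisesFrom J M ∧
    ∃ 𝓡 : Set (Set S), 𝓡.Nonempty ∧ (∀ K ∈ 𝓡, IsGreenRClass K ∧ K ⊆ J) ∧ M ∩ J = ⋃₀ 𝓡

end Semigroups

/-! ### Partial transformations -/

/-- Partial transformations of degree `n`, i.e. partial maps of an `n`-element chain to itself.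
The chain is `Fin n`, and `α i = none` says that `α` is undefined at `i`. -/
def PT (n : ℕ) : Type := Fin n → Option (Fin n)

namespace PT

variable {n : ℕ}

/-- Composition as binary relations: `α * β` is first `α`, then `β`. -/
instance : Monoid (PT n) where
  mul α β := fun i => (α i).bind β
  one := fun i => some i
  mul_assoc α β γ := funext fun i => Option.bind_assoc (α i) β γ
  one_mul _ := rfl
  mul_one α := funext fun i => Option.bind_fun_some (α i)

/-- The domain of a partial transformation. -/
def dom (α : PT n) : Set (Fin n) := {i | ∃ j, α i = some j}

/-- The image of a partial transformation. -/
def im (α : PT n) : Set (Fin n) := {j | ∃ i, α i = some j}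

/-- The kernel of a partial transformation, as a relation on its domain. -/
def ker (α : PT n) : Set (Fin n × Fin n) := {p | p.1 ∈ dom α ∧ p.2 ∈ dom α ∧ α p.1 = α p.2}

/-- The rank of a partial transformation. -/
noncomputable def rank (α : PT n) : ℕ := (im α).ncard

/-- `α` preserves the usual order wherever it is defined. -/
def OrderPreserving (α : PT n) : Prop :=
  ∀ i j a b : Fin n, i ≤ j → α i = some a → α j = some b → a ≤ b

/-- The partial transformations of degree `n` and rank `n - 1` (used for `n ≥ 1` only). -/
def J (n : ℕ) : Set (PT n) := {α | rank α = n - 1}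

/-- The partial transformations of rank `n - 1` without `i` in the image. -/
def L (i : Fin n) : Set (PT n) := {α | α ∈ J n ∧ i ∉ im α}

/-- The partial transformations of rank `n - 1` without `i` in the domain. -/
def R (i : Fin n) : Set (PT n) := {α | α ∈ J n ∧ i ∉ dom α}

/-- The partial transformations of rank `n - 1` with `(i, j)` in the kernel, for `i ≠ j`. -/
def RPair (i j : Fin n) : Set (PT n) := {α | α ∈ J n ∧ (i, j) ∈ ker α}

end PT

/-- The monoid of order-preserving partial transformations of degree `n`. -/
def PO (n : ℕ) : Submonoid (PT n) where
  carrier := {α | α.OrderPreserving}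
  one_mem' := by
    intro i j a b hij ha hb
    have ha' : i = a := Option.some.inj ha
    have hb' : j = b := Option.some.inj hb
    exact ha' ▸ hb' ▸ hij
  mul_mem' := by
    intro α β hα hβ i j a b hij ha hb
    obtain ⟨a', ha', ha''⟩ := Option.bind_eq_some_iff.mp ha
    obtain ⟨b', hb', hb''⟩ := Option.bind_eq_some_iff.mp hb
    exact hβ a' b' a b (hα i j a' b' hij ha' hb') ha'' hb''

/-- `X ∩ PO n`, as a subset of the monoid `PO n`. -/
def inPO {n : ℕ} (X : Set (PT n)) : Set (PO n) := {α | (α : PT n) ∈ X}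

/-- The union of `PO n \ J`, of the sets `L i ∩ PO n` with `i ∈ A`, of the sets `R i ∩ PO n` with
`i ∉ A`, and of the sets `R {i, i + 1} ∩ PO n` with `i, i + 1 ∉ A`, where `J`, `L i`, `R i` and
`R {i, i + 1}` consist of partial transformations of rank `n - 1`. -/
def rectangleSet (n : ℕ) (A : Set (Fin n)) : Set (PO n) :=
  (inPO (PT.J n))ᶜ ∪
    ((⋃ i ∈ A, inPO (PT.L i)) ∪ (⋃ i ∈ Aᶜ, inPO (PT.R i)) ∪
      ⋃ (i : Fin n) (j : Fin n) (_ : (i : ℕ) + 1 = j) (_ : i ∉ A ∧ j ∉ A), inPO (PT.RPair i j))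

/-! Write n = m + 1. An order-preserving map of rank m is determined by its kernel type `k` (one
point left out of the domain, or two adjacent points identified) and by the point `j` missing from
its image; call it `δ k j`. Let `N k` be the set of points that can be dropped from the domain
without shrinking the image: the omitted point, or the two identified ones. Then `δ k a * δ k' j`
equals `δ k j` if `a ∈ N k'` and has rank below m otherwise. Together with 1 these elements generate
the monoid, so only 1 and the grid of the `δ k j` matter.

A proper subsemigroup T misses 1, or misses a whole row `k`, or meets every row but misses some `δ
k₀ j₀`. In the last case let A be the set of `j` with `δ k₀ j ∈ T`. If `δ k j ∈ T` and `a ∈ N k ∩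
A`, then `δ k₀ a * δ k j = δ k₀ j` lies in T, so `j ∈ A`. Hence T avoids the rectangle of all `δ k
j` with `j ∉ A` and `N k` meeting A. The complements of {1}, of the rows and of these rectangles are
proper subsemigroups, and none contains another, so they are exactly the maximal ones. Their number
is 1 + (2n - 1) + (2^n - 2).

The classification is carried by `exists_le_candidate` and `eq_of_candidate_le`; that the monoid
fits the scheme is `isTopClass_topElement`, whose main inputs are `exists_eq_topElement` and
`eq_top_of_topElement_mem`. -/

section TopClass

variable {S K I : Type*} [Monoid S]

/-- The elements of `S` other than `1` and the `δ k i`. -/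
def lowerPart (δ : K → I → S) : Set S := {x | x ≠ 1 ∧ ∀ k i, x ≠ δ k i}

/-- `S` has trivial group of units, and just below it a `J`-class consisting of the elements
`δ k i`, which multiply as in a Rees matrix semigroup over the trivial group with the set
`{(a, k) | a ∈ N k}` of non-zero matrix entries. -/
structure IsTopClass (N : K → Set I) (δ : K → I → S) : Prop where
  inj : ∀ {k k' i i'}, δ k i = δ k' i' → k = k' ∧ i = i'
  ne_one : ∀ k i, δ k i ≠ 1
  lower_mul : ∀ {x} y, x ∈ lowerPart δ → x * y ∈ lowerPart δ
  mul_lower : ∀ {x} y, x ∈ lowerPart δ → y * x ∈ lowerPart δ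
  mul_of_mem : ∀ {k a k' j}, a ∈ N k' → δ k a * δ k' j = δ k j
  mul_of_notMem : ∀ {k a k' j}, a ∉ N k' → δ k a * δ k' j ∈ lowerPart δ
  generates : ∀ T : Subsemigroup S, 1 ∈ T → (∀ k i, δ k i ∈ T) → T = ⊤
  -- `single` lets a rectangle determine its set A, `nonempty` makes the elements of a column left
  -- multiples of each other, and `two` keeps a rectangle from fitting inside one row.
  single : ∀ i, ∃ k, N k = {i}
  nonempty : ∀ k, (N k).Nonempty
  two : ∀ k i, ∃ k', k' ≠ k ∧ i ∈ N k'

/-! ### Classification of the maximal subsemigroups in the abstract setting -/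

namespace IsTopClass

variable {N : K → Set I} {δ : K → I → S}

theorem cases (_ : IsTopClass N δ) (x : S) :
    x = 1 ∨ (∃ k i, x = δ k i) ∨ x ∈ lowerPart δ := by
  by_cases h1 : x = 1
  · exact Or.inl h1
  · by_cases h2 : ∃ k i, x = δ k i
    · exact Or.inr (Or.inl h2)
    · push Not at h2
      exact Or.inr (Or.inr ⟨h1, h2⟩)

theorem mul_eq_one (h : IsTopClass N δ) {x y : S} (hxy : x * y = 1) : x = 1 ∧ y = 1 := by
  rcases h.cases x with rfl | ⟨k, i, rfl⟩ | hx
  · simpa using hxy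
  · rcases h.cases y with rfl | ⟨k', j, rfl⟩ | hy
    · simpa using hxy
    · by_cases hi : i ∈ N k'
      · rw [h.mul_of_mem hi] at hxy
        exact absurd hxy (h.ne_one _ _)
      · exact absurd hxy (h.mul_of_notMem hi).1
    · exact absurd hxy (h.mul_lower _ hy).1
  · exact absurd hxy (h.lower_mul _ hx).1

/-- If a product is one of the `δ k j`, then each factor is `1` or some `δ k' j'`. -/
theorem mul_eq_delta (h : IsTopClass N δ) {x y : S} {k : K} {j : I} (hxy : x * y = δ k j) :
    (x = 1 ∧ y = δ k j) ∨ (x = δ k j ∧ y = 1) ∨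
      ∃ a k', a ∈ N k' ∧ x = δ k a ∧ y = δ k' j := by
  rcases h.cases x with rfl | ⟨k₁, i, rfl⟩ | hx
  · exact Or.inl ⟨rfl, by simpa using hxy⟩
  · rcases h.cases y with rfl | ⟨k', j', rfl⟩ | hy
    · exact Or.inr (Or.inl ⟨by simpa using hxy, rfl⟩)
    · by_cases hi : i ∈ N k'
      · rw [h.mul_of_mem hi] at hxy
        obtain ⟨rfl, rfl⟩ := h.inj hxy
        exact Or.inr (Or.inr ⟨i, k', hi, rfl, rfl⟩)
      · exact absurd hxy ((h.mul_of_notMem hi).2 _ _)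
    · exact absurd hxy ((h.mul_lower _ hy).2 _ _)
  · exact absurd hxy ((h.lower_mul _ hx).2 _ _)

/-- The complement of the identity. -/
def oneCompl (h : IsTopClass N δ) : Subsemigroup S where
  carrier := {1}ᶜ
  mul_mem' hx _ hxy := hx (h.mul_eq_one hxy).1

/-- The complement of the `R`-class with index `k`. -/
def rowCompl (h : IsTopClass N δ) (k : K) : Subsemigroup S where
  carrier := (range (δ k))ᶜ
  mul_mem' := by
    rintro x y hx hy ⟨j, hj⟩
    rcases h.mul_eq_delta hj.symm with ⟨-, rfl⟩ | ⟨rfl, -⟩ | ⟨a, k', -, rfl, -⟩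
    · exact hy ⟨_, rfl⟩
    · exact hx ⟨_, rfl⟩
    · exact hx ⟨_, rfl⟩

/-- The complement of the rectangle of all `δ k j` with `j ∉ A` and `N k` meeting `A`. -/
def rectCompl (h : IsTopClass N δ) (A : Set I) : Subsemigroup S where
  carrier := {x | ∃ k j, x = δ k j ∧ j ∉ A ∧ (N k ∩ A).Nonempty}ᶜ
  mul_mem' := by
    rintro x y hx hy ⟨k, j, hj, hjA, hkA⟩
    rcases h.mul_eq_delta hj with ⟨-, rfl⟩ | ⟨rfl, -⟩ | ⟨a, k', ha, rfl, rfl⟩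
    · exact hy ⟨_, _, rfl, hjA, hkA⟩
    · exact hx ⟨_, _, rfl, hjA, hkA⟩
    -- The inner index `a` decides which factor lies in the rectangle: the right one if `a ∈ A`, the
    -- left one if not.
    · by_cases haA : a ∈ A
      · exact hy ⟨_, _, rfl, hjA, a, ha, haA⟩
      · exact hx ⟨_, _, rfl, haA, hkA⟩

theorem delta_notMem_rectCompl (h : IsTopClass N δ) {A : Set I} {k : K} {j : I} :
    δ k j ∉ h.rectCompl A ↔ j ∉ A ∧ (N k ∩ A).Nonempty := by
  constructor
  · intro hkj
    obtain ⟨k', j', hk, hj⟩ := of_not_not hkj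
    obtain ⟨rfl, rfl⟩ := h.inj hk
    exact hj
  · exact fun hkj hn => hn ⟨k, j, rfl, hkj⟩

theorem delta_notMem_rowCompl (h : IsTopClass N δ) {k k' : K} {j : I} :
    δ k' j ∉ h.rowCompl k ↔ k' = k := by
  constructor
  · intro hk
    obtain ⟨j', hj⟩ := of_not_not hk
    exact (h.inj hj).1.symm
  · rintro rfl hn
    exact hn ⟨j, rfl⟩

theorem delta_mem_oneCompl (h : IsTopClass N δ) {k : K} {j : I} : δ k j ∈ h.oneCompl :=
  h.ne_one k j

theorem one_notMem_oneCompl (h : IsTopClass N δ) : (1 : S) ∉ h.oneCompl := fun hn => hn rfl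

theorem one_mem_rectCompl (h : IsTopClass N δ) (A : Set I) : (1 : S) ∈ h.rectCompl A := by
  rintro ⟨k, j, hkj, -⟩
  exact h.ne_one _ _ hkj.symm

theorem one_mem_rowCompl (h : IsTopClass N δ) (k : K) : (1 : S) ∈ h.rowCompl k := by
  rintro ⟨j, hj⟩
  exact h.ne_one _ _ hj

/-- The candidates for maximal subsemigroups. -/
def candidate (h : IsTopClass N δ) :
    Option (K ⊕ {A : Set I // A.Nonempty ∧ A ≠ univ}) → Subsemigroup S
  | none => h.oneCompl
  | some (Sum.inl k) => h.rowCompl k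
  | some (Sum.inr A) => h.rectCompl A

/-- The three kinds of candidate are the three ways in which a subsemigroup can fail to contain the
generators. -/
theorem exists_le_candidate (h : IsTopClass N δ) {T : Subsemigroup S} (hT : T ≠ ⊤) :
    ∃ p, T ≤ h.candidate p := by
  by_cases h1 : (1 : S) ∈ T
  swap
  · exact ⟨none, fun x hx hx1 => h1 (by rw [mem_singleton_iff] at hx1; exact hx1 ▸ hx)⟩
  by_cases hk : ∃ k, ∀ j, δ k j ∉ T
  · obtain ⟨k, hk⟩ := hk
    refine ⟨some (Sum.inl k), fun x hx => ?_⟩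
    rintro ⟨j, rfl⟩
    exact hk j hx
  push Not at hk
  have : ∃ k j, δ k j ∉ T := by
    by_contra! hall
    exact hT (h.generates T h1 hall)
  obtain ⟨k₀, j₀, h₀⟩ := this
  -- A is the trace of T on row `k₀`; it is non-empty because T meets each row, and proper because
  -- of `j₀`.
  refine ⟨some (Sum.inr ⟨{j | δ k₀ j ∈ T}, hk k₀, fun hu => h₀ (hu ▸ mem_univ j₀ :)⟩), ?_⟩
  rintro x hx ⟨k, j, rfl, hj, a, ha, haT⟩
  exact hj (by simpa [h.mul_of_mem ha] using T.mul_mem haT hx)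

theorem candidate_ne_top (h : IsTopClass N δ) [Nonempty I] (p) : h.candidate p ≠ ⊤ := by
  intro hp
  rcases p with _ | k | ⟨A, ⟨a, ha⟩, hA'⟩
  · exact h.one_notMem_oneCompl (hp ▸ Subsemigroup.mem_top 1 :)
  · obtain ⟨j⟩ := ‹Nonempty I›
    exact h.delta_notMem_rowCompl.2 rfl (hp ▸ Subsemigroup.mem_top (δ k j) :)
  · obtain ⟨j, hj⟩ := (ne_univ_iff_exists_notMem A).1 hA'
    obtain ⟨k, hk⟩ := h.single a
    refine h.delta_notMem_rectCompl.2 ⟨hj, a, ?_, ha⟩ (hp ▸ Subsemigroup.mem_top (δ k j) :)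
    simp [hk]

/-- Inclusion of candidates is reverse inclusion of the removed sets, and each removed set has an
element which a different candidate keeps. -/
theorem eq_of_candidate_le (h : IsTopClass N δ) [Nonempty I] {p q}
    (hpq : h.candidate p ≤ h.candidate q) : p = q := by
  obtain ⟨i⟩ := ‹Nonempty I›
  rcases p with _ | k | ⟨A, ⟨a, ha⟩, hA⟩ <;> rcases q with _ | l | ⟨B, ⟨b, hb⟩, hB⟩
  · rfl
  · exact absurd (hpq (h.delta_mem_oneCompl (k := l) (j := i))) (h.delta_notMem_rowCompl.2 rfl)
  · obtain ⟨j, hj⟩ := (ne_univ_iff_exists_notMem B).1 hB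
    obtain ⟨k, hk⟩ := h.single b
    exact absurd (hpq (h.delta_mem_oneCompl (k := k) (j := j)))
      (h.delta_notMem_rectCompl.2 ⟨hj, b, by simp [hk], hb⟩)
  · exact absurd (hpq (h.one_mem_rowCompl k)) h.one_notMem_oneCompl
  · have : δ l i ∉ h.rowCompl k := fun hn => h.delta_notMem_rowCompl.2 rfl (hpq hn)
    rw [h.delta_notMem_rowCompl.1 this]
  · obtain ⟨j, hj⟩ := (ne_univ_iff_exists_notMem B).1 hB
    -- The rectangle of B also has elements in a row other than `k`.
    obtain ⟨k', hk', hbk⟩ := h.two k b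
    have : δ k' j ∉ h.rowCompl k := fun hn =>
      h.delta_notMem_rectCompl.2 ⟨hj, b, hbk, hb⟩ (hpq hn)
    exact absurd (h.delta_notMem_rowCompl.1 this) hk'
  · exact absurd (hpq (h.one_mem_rectCompl A)) h.one_notMem_oneCompl
  · have : δ l a ∉ h.rectCompl A := fun hn => h.delta_notMem_rowCompl.2 rfl (hpq hn)
    exact absurd ha (h.delta_notMem_rectCompl.1 this).1
  · have key : ∀ k j, j ∉ B → (N k ∩ B).Nonempty → j ∉ A ∧ (N k ∩ A).Nonempty :=
      fun k j hj hk => h.delta_notMem_rectCompl.1 fun hn =>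
        h.delta_notMem_rectCompl.2 ⟨hj, hk⟩ (hpq hn)
    obtain ⟨j₀, hj₀⟩ := (ne_univ_iff_exists_notMem B).1 hB
    obtain ⟨k₀, hk₀⟩ := h.single b
    have : A = B := by
      ext c
      constructor
      · intro hc
        by_contra hcB
        exact (key k₀ c hcB ⟨b, by simp [hk₀], hb⟩).1 hc
      · intro hc
        obtain ⟨k, hk⟩ := h.single c
        obtain ⟨d, hd, hdA⟩ := (key k j₀ hj₀ ⟨c, by simp [hk], hc⟩).2
        rw [hk] at hd
        exact (mem_singleton_iff.1 hd) ▸ hdA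
    subst this
    rfl

theorem isCoatom_iff (h : IsTopClass N δ) [Nonempty I] {T : Subsemigroup S} :
    IsCoatom T ↔ ∃ p, T = h.candidate p := by
  constructor
  · intro hT
    obtain ⟨p, hp⟩ := h.exists_le_candidate hT.1
    exact ⟨p, (hT.le_iff_eq (h.candidate_ne_top p)).1 hp |>.symm⟩
  · rintro ⟨p, rfl⟩
    refine ⟨h.candidate_ne_top p, fun T hT => ?_⟩
    by_contra hne
    obtain ⟨q, hq⟩ := h.exists_le_candidate hne
    obtain rfl := h.eq_of_candidate_le (hT.le.trans hq)
    exact absurd hT hq.not_gt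

theorem setOf_isMaximalSubsemigroup (h : IsTopClass N δ) [Nonempty I] :
    {M : Set S | IsMaximalSubsemigroup M} = range fun p => (h.candidate p : Set S) := by
  ext M
  constructor
  · rintro ⟨T, rfl, hT⟩
    obtain ⟨p, rfl⟩ := h.isCoatom_iff.1 hT
    exact ⟨p, rfl⟩
  · rintro ⟨p, rfl⟩
    exact ⟨_, rfl, h.isCoatom_iff.2 ⟨p, rfl⟩⟩

theorem ncard_maximal (h : IsTopClass N δ) [Finite I] [Finite K] [Nonempty I] :
    {M : Set S | IsMaximalSubsemigroup M}.ncard = 2 ^ Nat.card I + Nat.card K - 1 := by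
  rw [h.setOf_isMaximalSubsemigroup, ← image_univ, ncard_image_of_injective, ncard_univ,
    Finite.card_option, Nat.card_sum]
  · have h1 : Nat.card {A : Set I // A.Nonempty ∧ A ≠ univ} + 2 = 2 ^ Nat.card I := by
      have h2 : {A : Set I | A.Nonempty ∧ A ≠ univ} = ({∅, univ} : Set (Set I))ᶜ := by
        ext A
        simp [nonempty_iff_ne_empty]
      have h3 := ncard_add_ncard_compl ({∅, univ} : Set (Set I))
      rw [ncard_pair empty_ne_univ, ← h2] at h3
      have h4 : Nat.card (Set I) = 2 ^ Nat.card I := by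
        have := Fintype.ofFinite I
        classical
        simp [Nat.card_eq_fintype_card]
      rw [← h4, ← h3, add_comm]
      rfl
    omega
  · intro p q hpq
    exact h.eq_of_candidate_le (le_of_eq (SetLike.coe_injective hpq))

/-! Green's classes -/

theorem isGreenJClass_one (h : IsTopClass N δ) : IsGreenJClass ({1} : Set S) := by
  refine ⟨1, ?_⟩
  ext y
  constructor
  · rintro rfl
    rfl
  · intro hy
    have : (1 : S) ∈ principalIdeal y := by
      rw [show principalIdeal y = principalIdeal 1 from hy]
      exact Or.inr rfl
    rcases this with ((⟨s, t, hst⟩ | ⟨s, hs⟩) | ⟨s, hs⟩) | hs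
    · exact (h.mul_eq_one (h.mul_eq_one hst.symm).1).2
    · exact (h.mul_eq_one hs.symm).2
    · exact (h.mul_eq_one hs.symm).1
    · exact hs.symm

theorem principalRightIdeal_eq_iff (h : IsTopClass N δ) {k : K} {j : I} {y : S} :
    principalRightIdeal y = principalRightIdeal (δ k j) ↔ y ∈ range (δ k) := by
  have sub : ∀ a b, principalRightIdeal (δ k a) ⊆ principalRightIdeal (δ k b) := by
    intro a b
    obtain ⟨l, hl⟩ := h.single b
    have hab : δ k a = δ k b * δ l a := (h.mul_of_mem (by simp [hl])).symm
    rintro x (⟨s, rfl⟩ | rfl)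
    · exact Or.inl ⟨δ l a * s, by rw [hab, mul_assoc]⟩
    · exact Or.inl ⟨_, hab⟩
  constructor
  · intro hy
    have : δ k j ∈ principalRightIdeal y := hy ▸ Or.inr rfl
    rcases this with ⟨s, hs⟩ | hs
    · rcases h.mul_eq_delta hs.symm with ⟨rfl, -⟩ | ⟨rfl, -⟩ | ⟨a, k', -, rfl, -⟩
      -- If `y` were 1, then 1 would be a right multiple of `δ k j`, although the group of units is
      -- trivial.
      · have : (1 : S) ∈ principalRightIdeal (δ k j) := hy ▸ Or.inr rfl
        rcases this with ⟨t, ht⟩ | ht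
        · exact absurd (h.mul_eq_one ht.symm).1 (h.ne_one _ _)
        · exact absurd ht.symm (h.ne_one _ _)
      · exact ⟨_, rfl⟩
      · exact ⟨_, rfl⟩
    · exact ⟨j, hs⟩
  · rintro ⟨a, rfl⟩
    exact (sub _ _).antisymm (sub _ _)

theorem principalLeftIdeal_eq_iff (h : IsTopClass N δ) {k : K} {j : I} {y : S} :
    principalLeftIdeal y = principalLeftIdeal (δ k j) ↔ ∃ l, y = δ l j := by
  have sub : ∀ a b, principalLeftIdeal (δ a j) ⊆ principalLeftIdeal (δ b j) := by
    intro a b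
    obtain ⟨i, hi⟩ := h.nonempty b
    have hab : δ a j = δ a i * δ b j := (h.mul_of_mem hi).symm
    rintro x (⟨s, rfl⟩ | rfl)
    · exact Or.inl ⟨s * δ a i, by rw [hab, mul_assoc]⟩
    · exact Or.inl ⟨_, hab⟩
  constructor
  · intro hy
    have : δ k j ∈ principalLeftIdeal y := hy ▸ Or.inr rfl
    rcases this with ⟨s, hs⟩ | hs
    · rcases h.mul_eq_delta hs.symm with ⟨-, rfl⟩ | ⟨-, rfl⟩ | ⟨a, k', -, -, rfl⟩
      · exact ⟨_, rfl⟩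
      · have : (1 : S) ∈ principalLeftIdeal (δ k j) := hy ▸ Or.inr rfl
        rcases this with ⟨t, ht⟩ | ht
        · exact absurd (h.mul_eq_one ht.symm).2 (h.ne_one _ _)
        · exact absurd ht.symm (h.ne_one _ _)
      · exact ⟨_, rfl⟩
    · exact ⟨k, hs.symm⟩
  · rintro ⟨a, rfl⟩
    exact (sub _ _).antisymm (sub _ _)

theorem isGreenRClass_range (h : IsTopClass N δ) [Nonempty I] (k : K) :
    IsGreenRClass (range (δ k)) :=
  ⟨δ k (Classical.arbitrary I), by ext y; exact h.principalRightIdeal_eq_iff.symm⟩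

theorem isGreenLClass_range (h : IsTopClass N δ) (i : I) :
    IsGreenLClass (range fun k => δ k i) := by
  obtain ⟨k, -⟩ := h.single i
  refine ⟨δ k i, ?_⟩
  ext y
  refine Iff.trans ?_ h.principalLeftIdeal_eq_iff.symm
  simp [eq_comm]

theorem isGreenRClass_subset_iff (h : IsTopClass N δ) [Nonempty I] {R : Set S} :
    IsGreenRClass R ∧ R ⊆ {x | ∃ k i, x = δ k i} ↔ ∃ k, R = range (δ k) := by
  constructor
  · rintro ⟨⟨x, rfl⟩, hR⟩
    obtain ⟨k, i, rfl⟩ := hR (rfl : x ∈ {y | principalRightIdeal y = principalRightIdeal x})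
    exact ⟨k, by ext y; exact h.principalRightIdeal_eq_iff⟩
  · rintro ⟨k, rfl⟩
    refine ⟨h.isGreenRClass_range k, ?_⟩
    rintro _ ⟨i, rfl⟩
    exact ⟨k, i, rfl⟩

theorem isGreenJClass_delta (h : IsTopClass N δ) [Nonempty I] :
    IsGreenJClass {x | ∃ k i, x = δ k i} := by
  obtain ⟨i⟩ := ‹Nonempty I›
  obtain ⟨k, -⟩ := h.single i
  have sub : ∀ k i k' i', principalIdeal (δ k i) ⊆ principalIdeal (δ k' i') := by
    intro k i k' i'
    obtain ⟨a, ha⟩ := h.nonempty k'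
    obtain ⟨l, hl⟩ := h.single i'
    have hab : δ k i = δ k a * δ k' i' * δ l i := by
      rw [h.mul_of_mem ha, h.mul_of_mem (by simp [hl])]
    rintro x (((⟨s, t, rfl⟩ | ⟨s, rfl⟩) | ⟨s, rfl⟩) | rfl)
    · exact Or.inl (Or.inl (Or.inl ⟨s * δ k a, δ l i * t, by simp only [hab, mul_assoc]⟩))
    · exact Or.inl (Or.inl (Or.inl ⟨s * δ k a, δ l i, by simp only [hab, mul_assoc]⟩))
    · exact Or.inl (Or.inl (Or.inl ⟨δ k a, δ l i * s, by simp only [hab, mul_assoc]⟩))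
    · exact Or.inl (Or.inl (Or.inl ⟨δ k a, δ l i, hab⟩))
  refine ⟨δ k i, ?_⟩
  ext y
  constructor
  · rintro ⟨k', i', rfl⟩
    exact (sub _ _ _ _).antisymm (sub _ _ _ _)
  · intro hy
    have hy : principalIdeal y = principalIdeal (δ k i) := hy
    rcases h.cases y with rfl | hy' | hlow
    · have : (1 : S) ∈ principalIdeal (δ k i) := hy ▸ Or.inr rfl
      rcases this with ((⟨s, t, hst⟩ | ⟨s, hs⟩) | ⟨s, hs⟩) | hs
      · exact absurd (h.mul_eq_one (h.mul_eq_one hst.symm).1).2 (h.ne_one _ _)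
      · exact absurd (h.mul_eq_one hs.symm).2 (h.ne_one _ _)
      · exact absurd (h.mul_eq_one hs.symm).1 (h.ne_one _ _)
      · exact absurd hs.symm (h.ne_one _ _)
    · exact hy'
    · have : δ k i ∈ principalIdeal y := hy ▸ Or.inr rfl
      rcases this with ((⟨s, t, hst⟩ | ⟨s, hs⟩) | ⟨s, hs⟩) | hs
      · exact absurd hst.symm ((h.lower_mul _ (h.mul_lower _ hlow)).2 _ _)
      · exact absurd hs.symm ((h.mul_lower _ hlow).2 _ _)
      · exact absurd hs.symm ((h.lower_mul _ hlow).2 _ _)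
      · exact absurd hs.symm (hlow.2 _ _)

/-! Types of the maximal subsemigroups -/

theorem isMaximalSubsemigroup_candidate (h : IsTopClass N δ) [Nonempty I] (p) :
    IsMaximalSubsemigroup (h.candidate p : Set S) :=
  ⟨_, rfl, h.isCoatom_iff.2 ⟨p, rfl⟩⟩

theorem maximalOfTypeM1 (h : IsTopClass N δ) [Nonempty I] :
    MaximalOfTypeM1 ({1} : Set S) ({1} : Set S)ᶜ :=
  ⟨⟨h.isGreenJClass_one, h.isMaximalSubsemigroup_candidate none, by simp⟩, by simp⟩

theorem maximalOfTypeM4 (h : IsTopClass N δ) [Nonempty I] (k : K) :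
    MaximalOfTypeM4 {x | ∃ k i, x = δ k i} (range (δ k))ᶜ := by
  refine ⟨⟨h.isGreenJClass_delta, h.isMaximalSubsemigroup_candidate (some (Sum.inl k)), ?_⟩,
    {R | ∃ k', k' ≠ k ∧ R = range (δ k')}, ?_, ?_, ?_⟩
  · rw [compl_compl]
    exact (h.isGreenRClass_subset_iff.2 ⟨k, rfl⟩).2
  · obtain ⟨k', hk', -⟩ := h.two k (Classical.arbitrary I)
    exact ⟨_, k', hk', rfl⟩
  · rintro _ ⟨k', -, rfl⟩
    exact h.isGreenRClass_subset_iff.2 ⟨k', rfl⟩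
  · ext x
    constructor
    · rintro ⟨hx, k', i, rfl⟩
      exact ⟨_, ⟨k', fun hk => hx ⟨i, by rw [hk]⟩, rfl⟩, i, rfl⟩
    · rintro ⟨_, ⟨k', hk', rfl⟩, i, rfl⟩
      refine ⟨?_, k', i, rfl⟩
      rintro ⟨j, hj⟩
      exact hk' (h.inj hj).1.symm

theorem maximalOfTypeM2 (h : IsTopClass N δ) [Nonempty I] {A : Set I} (hA : A.Nonempty)
    (hA' : A ≠ univ) :
    MaximalOfTypeM2 {x | ∃ k i, x = δ k i} (h.rectCompl A : Set S) := by
  refine ⟨⟨h.isGreenJClass_delta,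
    h.isMaximalSubsemigroup_candidate (some (Sum.inr ⟨A, hA, hA'⟩)), ?_⟩,
    -- Outside the rectangle lie the columns with index in A and the rows whose `N k` avoids A.
    {L | ∃ i ∈ A, L = range fun k => δ k i}, {R | ∃ k, N k ⊆ Aᶜ ∧ R = range (δ k)},
    ?_, ?_, ?_, ?_, ?_⟩
  · rintro x hx
    obtain ⟨k, j, hkj, -⟩ := of_not_not hx
    exact ⟨k, j, hkj⟩
  · obtain ⟨a, ha⟩ := hA
    exact ⟨_, a, ha, rfl⟩
  · obtain ⟨b, hb⟩ := (ne_univ_iff_exists_notMem A).1 hA'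
    obtain ⟨k, hk⟩ := h.single b
    exact ⟨_, k, by simpa [hk] using hb, rfl⟩
  · rintro _ ⟨i, -, rfl⟩
    refine ⟨h.isGreenLClass_range i, ?_⟩
    rintro _ ⟨k, rfl⟩
    exact ⟨k, i, rfl⟩
  · rintro _ ⟨k, -, rfl⟩
    exact h.isGreenRClass_subset_iff.2 ⟨k, rfl⟩
  · ext x
    constructor
    · rintro ⟨hx, k, j, rfl⟩
      by_cases hj : j ∈ A
      · exact Or.inl ⟨_, ⟨j, hj, rfl⟩, k, rfl⟩
      · refine Or.inr ⟨_, ⟨k, fun a ha haA => ?_, rfl⟩, j, rfl⟩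
        exact h.delta_notMem_rectCompl.2 ⟨hj, a, ha, haA⟩ hx
    · rintro (⟨_, ⟨j, hj, rfl⟩, k, rfl⟩ | ⟨_, ⟨k, hk, rfl⟩, j, rfl⟩)
      · exact ⟨of_not_not fun hn => (h.delta_notMem_rectCompl.1 hn).1 hj, k, j, rfl⟩
      · refine ⟨of_not_not fun hn => ?_, k, j, rfl⟩
        obtain ⟨a, ha, haA⟩ := (h.delta_notMem_rectCompl.1 hn).2
        exact hk ha haA

end IsTopClass

end TopClass

/-! ### Order-preserving maps of rank `n - 1` -/

section Rank

variable {m : ℕ}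

/-- The index set of the `R`-classes of rank `m` in `PO (m + 1)`. -/
abbrev KernelType (m : ℕ) : Type := Fin (m + 1) ⊕ Fin m

/-! ### Kernel types and the corresponding surjections onto a chain of m points -/

namespace KernelType

/-- The points which can be removed from the domain without making the image smaller. -/
def redundant : KernelType m → Set (Fin (m + 1))
  | Sum.inl i => {i}
  | Sum.inr p => {p.castSucc, p.succ}

/-- The order-preserving partial map onto `Fin m` which is undefined at one point, or which
identifies two adjacent points. -/
def proj : KernelType m → Fin (m + 1) → Option (Fin m)
  | Sum.inl i => finSuccEquiv' i
  | Sum.inr p => fun x => some (p.predAbove x)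

theorem proj_succAbove {k : KernelType m} {a : Fin (m + 1)} (ha : a ∈ redundant k) (x : Fin m) :
    proj k (a.succAbove x) = some x := by
  rcases k with i | p
  · obtain rfl : a = i := ha
    exact finSuccEquiv'_succAbove _ _
  · rcases ha with rfl | rfl
    · exact congrArg some (Fin.predAbove_succAbove p x)
    · refine congrArg some ?_
      apply Fin.succAbove_right_injective (p := p.succ)
      exact Fin.succ_succAbove_predAbove (Fin.succAbove_ne _ _)

/-- A point that is not redundant is the only preimage of its value, so omitting it loses that
value. This is what makes products drop in rank. -/
theorem proj_of_notMem {k : KernelType m} {a : Fin (m + 1)} (ha : a ∉ redundant k) :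
    ∃ v, proj k a = some v ∧ ∀ x, proj k x = some v → x = a := by
  rcases k with i | p
  · obtain ⟨v, rfl⟩ := Fin.exists_succAbove_eq (show a ≠ i from ha)
    refine ⟨v, finSuccEquiv'_succAbove _ _, fun x hx => ?_⟩
    exact finSuccEquiv'_eq_some.1 hx
  · have h1 : a ≠ p.castSucc := fun h => ha (Or.inl h)
    have h2 : a ≠ p.succ := fun h => ha (Or.inr h)
    refine ⟨p.predAbove a, rfl, fun x hx => ?_⟩
    have hx : p.predAbove x = p.predAbove a := Option.some.inj hx
    by_cases hxp : x = p.castSucc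
    · have hxs : x ≠ p.succ := by
        rw [hxp]
        exact Fin.castSucc_lt_succ.ne
      rw [← Fin.succ_succAbove_predAbove hxs, hx, Fin.succ_succAbove_predAbove h2]
    · rw [← Fin.succAbove_predAbove hxp, hx, Fin.succAbove_predAbove h1]

theorem proj_le {k : KernelType m} {x y : Fin (m + 1)} {a b : Fin m} (hxy : x ≤ y)
    (hx : proj k x = some a) (hy : proj k y = some b) : a ≤ b := by
  rcases k with i | p
  · obtain rfl := finSuccEquiv'_eq_some.1 hx
    obtain rfl := finSuccEquiv'_eq_some.1 hy
    exact Fin.succAbove_le_succAbove_iff.1 hxy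
  · obtain rfl := Option.some.inj hx
    obtain rfl := Option.some.inj hy
    exact Fin.predAbove_right_monotone p hxy

theorem redundant_nonempty (k : KernelType m) : (redundant k).Nonempty := by
  rcases k with i | p
  · exact ⟨i, rfl⟩
  · exact ⟨p.castSucc, Or.inl rfl⟩

theorem redundant_injective : Function.Injective (redundant (m := m)) := by
  rintro (i | p) (j | q) h
  · rw [singleton_injective (show ({i} : Set (Fin (m + 1))) = {j} from h)]
  · have h1 : q.castSucc ∈ redundant (Sum.inl i : KernelType m) := h ▸ Or.inl rfl
    have h2 : q.succ ∈ redundant (Sum.inl i : KernelType m) := h ▸ Or.inr rfl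
    exact absurd (h1.trans h2.symm) Fin.castSucc_lt_succ.ne
  · have h1 : p.castSucc ∈ redundant (Sum.inl j : KernelType m) := h ▸ Or.inl rfl
    have h2 : p.succ ∈ redundant (Sum.inl j : KernelType m) := h ▸ Or.inr rfl
    exact absurd (h1.trans h2.symm) Fin.castSucc_lt_succ.ne
  · have h1 : p.castSucc ∈ redundant (Sum.inr q : KernelType m) := h ▸ Or.inl rfl
    have h2 : p.succ ∈ redundant (Sum.inr q : KernelType m) := h ▸ Or.inr rfl
    have : p = q := by
      simp only [redundant, mem_insert_iff, mem_singleton_iff, Fin.ext_iff, Fin.val_castSucc,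
        Fin.val_succ] at h1 h2
      ext
      omega
    rw [this]

theorem proj_injective : Function.Injective (proj (m := m)) := by
  have key : ∀ k k' : KernelType m, proj k = proj k' → redundant k ⊆ redundant k' := by
    intro k k' h a ha
    by_contra ha'
    obtain ⟨v, -, hv⟩ := proj_of_notMem ha'
    exact Fin.succAbove_ne _ _ (hv (a.succAbove v) (by rw [← h, proj_succAbove ha]))
  exact fun k k' h => redundant_injective ((key _ _ h).antisymm (key _ _ h.symm))

/-- An order-preserving partial map of a finite chain onto itself is the identity. -/
theorem eq_some_of_surjective {g : Fin m → Option (Fin m)}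
    (hg : ∀ x y a b, x ≤ y → g x = some a → g y = some b → a ≤ b)
    (hs : ∀ y, ∃ x, g x = some y) : g = some := by
  -- A section of `g` is strictly increasing, and a strictly increasing self-map of a finite chain
  -- is the identity.
  choose s hs using hs
  have hmono : StrictMono s := by
    intro y y' hy
    by_contra! hle
    exact absurd (hg _ _ _ _ hle (hs y') (hs y)) hy.not_ge
  have hid : ∀ y, s y = y := fun y => le_antisymm (hmono.le_id y) (hmono.id_le y)
  funext x
  rw [← hs x, hid]

/-- One point is superfluous: one where `g` is undefined, or, if `g` is total, the lower of two
adjacent points identified by the pigeonhole principle. Without it `g` is a map of a chain onto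
itself, hence the identity. -/
theorem exists_eq_proj {g : Fin (m + 1) → Option (Fin m)}
    (hg : ∀ x y a b, x ≤ y → g x = some a → g y = some b → a ≤ b)
    (hs : ∀ y, ∃ x, g x = some y) : ∃ k, g = proj k := by
  have key : ∀ i : Fin (m + 1), (∀ y, g i = some y → ∃ x, x ≠ i ∧ g x = some y) →
      ∀ x, g (i.succAbove x) = some x := by
    intro i hi
    refine congrFun (eq_some_of_surjective (g := fun x => g (i.succAbove x)) ?_ ?_)
    · exact fun x y a b hxy => hg _ _ a b (Fin.succAbove_le_succAbove_iff.2 hxy)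
    · intro y
      obtain ⟨x, hx⟩ := hs y
      by_cases hxi : x = i
      · subst hxi
        obtain ⟨z, hz, hzy⟩ := hi y hx
        obtain ⟨w, rfl⟩ := Fin.exists_succAbove_eq hz
        exact ⟨w, hzy⟩
      · obtain ⟨w, rfl⟩ := Fin.exists_succAbove_eq hxi
        exact ⟨w, hx⟩
  by_cases hnone : ∃ i, g i = none
  · obtain ⟨i, hi⟩ := hnone
    refine ⟨Sum.inl i, funext fun x => ?_⟩
    by_cases hx : x = i
    · rw [hx, hi]
      exact (finSuccEquiv'_at i).symm
    · obtain ⟨w, rfl⟩ := Fin.exists_succAbove_eq hx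
      rw [key i (by simp [hi])]
      exact (finSuccEquiv'_succAbove i w).symm
  · push Not at hnone
    choose f hf using fun i => Option.ne_none_iff_exists'.1 (hnone i)
    have hmono : Monotone f := fun x y hxy => hg x y _ _ hxy (hf x) (hf y)
    have hadj : ∃ p : Fin m, f p.castSucc = f p.succ := by
      by_contra! hne
      have : StrictMono f := Fin.strictMono_iff_lt_succ.2 fun p =>
        lt_of_le_of_ne (hmono Fin.castSucc_lt_succ.le) (hne p)
      have := Fintype.card_le_of_injective f this.injective
      simp at this
    obtain ⟨p, hp⟩ := hadj
    have hkey := key p.castSucc fun y hy =>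
      ⟨p.succ, Fin.castSucc_lt_succ.ne', by rw [← hy, hf, hf, hp]⟩
    refine ⟨Sum.inr p, funext fun x => ?_⟩
    by_cases hx : x = p.castSucc
    · have h1 := hkey p
      rw [Fin.succAbove_castSucc_self] at h1
      rw [hx, hf, hp, ← hf, h1]
      exact congrArg some (Fin.predAbove_castSucc_self p).symm
    · obtain ⟨w, rfl⟩ := Fin.exists_succAbove_eq hx
      rw [hkey]
      exact congrArg some (Fin.predAbove_succAbove p w).symm

end KernelType

open KernelType

/-! ### Rank, and the normal form of the elements of rank m -/

namespace PT

theorem rank_mul_le_right {n : ℕ} (α β : PT n) : rank (α * β) ≤ rank β := by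
  refine ncard_le_ncard ?_ (toFinite _)
  rintro j ⟨i, hi⟩
  obtain ⟨x, -, hx⟩ := Option.bind_eq_some_iff.1 hi
  exact ⟨x, hx⟩

theorem rank_mul_le_left {n : ℕ} (α β : PT n) : rank (α * β) ≤ rank α := by
  have h : some '' im (α * β) ⊆ β '' im α := by
    rintro _ ⟨j, ⟨i, hi⟩, rfl⟩
    obtain ⟨x, hx, hxj⟩ := Option.bind_eq_some_iff.1 hi
    exact ⟨x, ⟨i, hx⟩, hxj⟩
  calc rank (α * β) = (some '' im (α * β)).ncard :=
        (ncard_image_of_injective _ (Option.some_injective _)).symm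
    _ ≤ (β '' im α).ncard := ncard_le_ncard h (toFinite _)
    _ ≤ rank α := ncard_image_le (toFinite _)

theorem rank_one {n : ℕ} : rank (1 : PT n) = n := by
  have : im (1 : PT n) = univ := eq_univ_of_forall fun i => ⟨i, rfl⟩
  simp [rank, this]

theorem eq_one_of_rank_eq {n : ℕ} {α : PT n} (hα : α.OrderPreserving) (h : rank α = n) :
    α = 1 := by
  have him : im α = univ :=
    eq_of_subset_of_ncard_le (subset_univ _) (by simp [show (im α).ncard = n from h])
  exact eq_some_of_surjective hα fun y => (him ▸ mem_univ y : y ∈ im α)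

end PT

/-- The element of `PO (m + 1)` of rank `m` with kernel type `k` and without `j` in its image. -/
def topElement (k : KernelType m) (j : Fin (m + 1)) : PO (m + 1) :=
  ⟨fun x => (proj k x).map j.succAbove, by
    intro x y a b hxy ha hb
    obtain ⟨c, hc, rfl⟩ := Option.map_eq_some_iff.1 ha
    obtain ⟨d, hd, rfl⟩ := Option.map_eq_some_iff.1 hb
    exact Fin.succAbove_le_succAbove_iff.2 (proj_le hxy hc hd)⟩

theorem topElement_apply (k : KernelType m) (j x : Fin (m + 1)) :
    (topElement k j : PT (m + 1)) x = (proj k x).map j.succAbove := rfl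

theorem im_topElement (k : KernelType m) (j : Fin (m + 1)) :
    PT.im (topElement k j : PT (m + 1)) = {j}ᶜ := by
  ext y
  constructor
  · rintro ⟨x, hx⟩
    obtain ⟨c, -, rfl⟩ := Option.map_eq_some_iff.1 hx
    exact Fin.succAbove_ne j c
  · intro hy
    obtain ⟨c, rfl⟩ := Fin.exists_succAbove_eq (show y ≠ j from hy)
    obtain ⟨a, ha⟩ := redundant_nonempty k
    refine ⟨a.succAbove c, ?_⟩
    rw [topElement_apply, proj_succAbove ha]
    rfl

theorem rank_topElement (k : KernelType m) (j : Fin (m + 1)) :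
    PT.rank (topElement k j : PT (m + 1)) = m := by
  rw [PT.rank, im_topElement]
  have := ncard_add_ncard_compl ({j} : Set (Fin (m + 1)))
  rw [ncard_singleton, Nat.card_fin] at this
  omega

theorem exists_eq_topElement {x : PO (m + 1)} (hx : PT.rank (x : PT (m + 1)) = m) :
    ∃ k j, x = topElement k j := by
  have hc : (PT.im (x : PT (m + 1)))ᶜ.ncard = 1 := by
    have := ncard_add_ncard_compl (PT.im (x : PT (m + 1)))
    rw [show (PT.im (x : PT (m + 1))).ncard = m from hx, Nat.card_fin] at this
    omega
  obtain ⟨j, hj⟩ := ncard_eq_one.1 hc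
  have him : ∀ y, y ∈ PT.im (x : PT (m + 1)) ↔ y ≠ j := by
    intro y
    rw [← not_iff_not, ← mem_compl_iff, hj]
    simp
  -- Closing the gap at `j` in the target turns `x` into a surjection onto `Fin m`.
  have hg : ∃ k, (fun i => ((x : PT (m + 1)) i).bind (finSuccEquiv' j)) = proj k := by
    apply exists_eq_proj
    · intro i i' a b hi ha hb
      obtain ⟨c, hc, hca⟩ := Option.bind_eq_some_iff.1 ha
      obtain ⟨d, hd, hdb⟩ := Option.bind_eq_some_iff.1 hb
      obtain rfl := finSuccEquiv'_eq_some.1 hca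
      obtain rfl := finSuccEquiv'_eq_some.1 hdb
      exact Fin.succAbove_le_succAbove_iff.1 (x.2 i i' _ _ hi hc hd)
    · intro y
      obtain ⟨i, hi⟩ := (him (j.succAbove y)).2 (Fin.succAbove_ne j y)
      exact ⟨i, by rw [hi]; exact finSuccEquiv'_succAbove j y⟩
  obtain ⟨k, hk⟩ := hg
  refine ⟨k, j, Subtype.ext (funext fun i => ?_)⟩
  rw [topElement_apply, ← hk]
  dsimp only
  cases hi : (x : PT (m + 1)) i with
  | none => simp
  | some y =>
    obtain ⟨c, rfl⟩ := Fin.exists_succAbove_eq ((him y).1 ⟨i, hi⟩)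
    simp [finSuccEquiv'_succAbove]

theorem topElement_inj {k k' : KernelType m} {j j' : Fin (m + 1)}
    (h : topElement k j = topElement k' j') : k = k' ∧ j = j' := by
  have hj : j = j' := by
    have := im_topElement k j
    rw [h, im_topElement] at this
    exact (singleton_injective (compl_injective this)).symm
  subst hj
  refine ⟨proj_injective (funext fun x => ?_), rfl⟩
  apply Option.map_injective (Fin.succAbove_right_injective (p := j))
  rw [← topElement_apply, ← topElement_apply, h]

theorem mem_lowerPart_iff {x : PO (m + 1)} :
    x ∈ lowerPart (topElement (m := m)) ↔ PT.rank (x : PT (m + 1)) < m := by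
  constructor
  · rintro ⟨h1, h2⟩
    have hle : PT.rank (x : PT (m + 1)) ≤ m + 1 := by
      have := ncard_le_card (PT.im (x : PT (m + 1)))
      rwa [Nat.card_fin] at this
    have hne : PT.rank (x : PT (m + 1)) ≠ m + 1 := fun h =>
      h1 (Subtype.ext (PT.eq_one_of_rank_eq x.2 h))
    have hne' : PT.rank (x : PT (m + 1)) ≠ m := fun h => by
      obtain ⟨k, j, hkj⟩ := exists_eq_topElement h
      exact h2 k j hkj
    omega
  · intro h
    refine ⟨?_, ?_⟩
    · rintro rfl
      rw [show ((1 : PO (m + 1)) : PT (m + 1)) = 1 from rfl, PT.rank_one] at h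
      omega
    · rintro k j rfl
      rw [rank_topElement] at h
      omega

theorem topElement_mul_of_mem {k k' : KernelType m} {a j : Fin (m + 1)} (ha : a ∈ redundant k') :
    topElement k a * topElement k' j = topElement k j := by
  refine Subtype.ext (funext fun x => ?_)
  change ((proj k x).map a.succAbove).bind (fun y => (proj k' y).map j.succAbove)
    = (proj k x).map j.succAbove
  cases proj k x with
  | none => rfl
  | some c => simp [proj_succAbove ha]

theorem topElement_mul_of_notMem {k k' : KernelType m} {a j : Fin (m + 1)}
    (ha : a ∉ redundant k') :
    topElement k a * topElement k' j ∈ lowerPart (topElement (m := m)) := by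
  rw [mem_lowerPart_iff]
  obtain ⟨v, hv, hva⟩ := proj_of_notMem ha
  -- Besides `j`, the image misses `j.succAbove v`: the value `v` is attained only at `a`, which the
  -- first factor omits.
  have hsub : PT.im (topElement k a * topElement k' j : PT (m + 1)) ⊆ {j, j.succAbove v}ᶜ := by
    rintro y ⟨x, hx⟩
    obtain ⟨z, hz, hzy⟩ := Option.bind_eq_some_iff.1 hx
    obtain ⟨c, -, rfl⟩ := Option.map_eq_some_iff.1 hz
    obtain ⟨d, hd, rfl⟩ := Option.map_eq_some_iff.1 hzy
    rintro (h | h)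
    · exact Fin.succAbove_ne j d h
    · obtain rfl := Fin.succAbove_right_injective h
      exact Fin.succAbove_ne a c (hva _ hd)
  have h1 := ncard_le_ncard hsub (toFinite _)
  have h2 := ncard_add_ncard_compl ({j, j.succAbove v} : Set (Fin (m + 1)))
  rw [ncard_pair (Fin.succAbove_ne j v).symm] at h2
  simp only [Nat.card_eq_fintype_card, Fintype.card_fin] at h2
  change (PT.im _).ncard < m
  rw [Submonoid.coe_mul]
  omega

/-! Generation by the elements of rank at least `m` -/

/-- The restriction of an order-preserving map to the complement of `D`. -/
def restrictCompl (f : Fin (m + 1) →o Fin (m + 1)) (D : Finset (Fin (m + 1))) : PO (m + 1) :=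
  ⟨fun x => if x ∈ D then none else some (f x), by
    intro x y a b hxy ha hb
    dsimp only at ha hb
    split_ifs at ha hb
    obtain rfl := Option.some.inj ha
    obtain rfl := Option.some.inj hb
    exact f.monotone hxy⟩

/-- `topElement (Sum.inl i) i` is the identity with `i` removed from its domain, so multiplying by
it on the left deletes one point. -/
theorem restrictCompl_insert (f : Fin (m + 1) →o Fin (m + 1)) (D : Finset (Fin (m + 1)))
    (i : Fin (m + 1)) :
    restrictCompl f (insert i D) = topElement (Sum.inl i) i * restrictCompl f D := by
  refine Subtype.ext (funext fun x => ?_)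
  change (if x ∈ insert i D then none else some (f x))
    = ((finSuccEquiv' i x).map i.succAbove).bind fun y => if y ∈ D then none else some (f y)
  by_cases hx : x = i
  · subst hx
    simp [finSuccEquiv'_at]
  · obtain ⟨w, rfl⟩ := Fin.exists_succAbove_eq hx
    simp [finSuccEquiv'_succAbove, Fin.succAbove_ne]

theorem exists_eq_restrictCompl (x : PO (m + 1)) : ∃ f D, x = restrictCompl f D := by
  let α : Fin (m + 1) → Option (Fin (m + 1)) := (x : PT (m + 1))
  -- The running maximum extends the map to all points; the default 0 is the least element, so
  -- undefined points do not affect it.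
  refine ⟨⟨fun i => (Finset.Iic i).sup fun y => (α y).getD 0, fun i j hij =>
    Finset.sup_mono (Finset.Iic_subset_Iic.2 hij)⟩, Finset.univ.filter fun i => α i = none, Subtype.ext (funext
    fun i => ?_)⟩
  change α i = if i ∈ _ then none else some ((Finset.Iic i).sup fun y => (α y).getD 0)
  cases hi : α i with
  | none => simp [hi]
  | some v =>
    have : (Finset.Iic i).sup (fun y => (α y).getD 0) = v := by
      apply le_antisymm
      · refine Finset.sup_le fun y hy => ?_
        cases hy' : α y with
        | none => exact Fin.zero_le v
        | some w => exact x.2 y i w v (Finset.mem_Iic.1 hy) hy' hi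
      · have := Finset.le_sup (f := fun y => (α y).getD 0) (Finset.mem_Iic.2 (le_refl i))
        simpa [hi] using this
    simp [hi, this]

theorem topElement_inr_castSucc_apply (p : Fin m) (x : Fin (m + 1)) :
    (topElement (Sum.inr p) p.castSucc : PT (m + 1)) x
      = some (if x = p.castSucc then p.succ else x) := by
  change some (p.castSucc.succAbove (p.predAbove x)) = _
  split_ifs with hx
  · rw [hx, Fin.predAbove_castSucc_self, Fin.succAbove_castSucc_self]
  · rw [Fin.succAbove_predAbove hx]

theorem topElement_inr_succ_apply (p : Fin m) (x : Fin (m + 1)) :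
    (topElement (Sum.inr p) p.succ : PT (m + 1)) x
      = some (if x = p.succ then p.castSucc else x) := by
  change some (p.succ.succAbove (p.predAbove x)) = _
  split_ifs with hx
  · rw [hx, Fin.predAbove_succ_self, Fin.succAbove_succ_self]
  · rw [Fin.succ_succAbove_predAbove hx]

/-- The sum of the distances between the points and their images. -/
def displacement (f : Fin (m + 1) → Fin (m + 1)) : ℕ := ∑ i, Nat.dist (f i) i

theorem displacement_update_lt {f : Fin (m + 1) → Fin (m + 1)} {p c : Fin (m + 1)}
    (h : Nat.dist c p < Nat.dist (f p) p) :
    displacement (Function.update f p c) < displacement f := by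
  refine Finset.sum_lt_sum (fun i _ => ?_) ⟨p, Finset.mem_univ p, by simpa using h⟩
  by_cases hi : i = p
  · subst hi
    simpa using h.le
  · simp [Function.update_of_ne hi]

/-- An order-preserving map which moves some point up collapses two adjacent points, and it can
be changed at the smaller one to reduce its displacement. -/
theorem exists_update_of_lt {f : Fin (m + 1) → Fin (m + 1)} (hf : Monotone f)
    (h : ∃ i, i < f i) : ∃ (p : Fin m) (c : Fin (m + 1)), f p.castSucc = f p.succ ∧
      Monotone (Function.update f p.castSucc c) ∧
      Nat.dist c p.castSucc < Nat.dist (f p.castSucc) p.castSucc := by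
  -- Let `i` be the last point moved up and `q` the first point of its fibre. If `q < i`, the fibre
  -- also contains the successor of `q`; if `q = i`, the successor is not moved up, which forces the
  -- same value there. Points before `q` have smaller values, so the value at `q` can be lowered by
  -- one.
  obtain ⟨i, hi, hmax⟩ := Set.Finite.exists_maximal (toFinite {i | i < f i}) h
  obtain ⟨q, hq, hmin⟩ := Set.Finite.exists_minimal (toFinite {x | f x = f i}) ⟨i, rfl⟩
  have hi : i < f i := hi
  have hq : f q = f i := hq
  have hlt : ∀ x, x < q → f x < f q := fun x hx =>
    lt_of_le_of_ne (hf hx.le) fun he => hx.not_ge (hmin (show f x = f i from he.trans hq) hx.le)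
  have hqi : q ≤ i := by
    by_contra! hlt'
    exact (hlt i hlt').ne hq.symm
  have hqlt : q < f q := hq ▸ hqi.trans_lt hi
  obtain ⟨p, rfl⟩ : ∃ p : Fin m, q = p.castSucc :=
    ⟨q.castPred (hqlt.trans_le (Fin.le_last _)).ne, by simp⟩
  have hps : f p.castSucc = f p.succ := by
    rcases hqi.lt_or_eq with hlt' | rfl
    · exact le_antisymm (hf Fin.castSucc_lt_succ.le)
        (hq ▸ hf (Fin.castSucc_lt_iff_succ_le.1 hlt'))
    · refine le_antisymm (hf Fin.castSucc_lt_succ.le) ?_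
      have h1 : ¬ p.succ < f p.succ := fun h1 =>
        absurd (hmax h1 Fin.castSucc_lt_succ.le) Fin.castSucc_lt_succ.not_ge
      exact (not_lt.1 h1).trans (Fin.castSucc_lt_iff_succ_le.1 hqlt)
  have hpos : 0 < (f p.castSucc : ℕ) := (Nat.zero_le _).trans_lt hqlt
  have hqn : (p.castSucc : ℕ) < f p.castSucc := hqlt
  refine ⟨p, ⟨f p.castSucc - 1, by omega⟩, hps, ?_, ?_⟩
  · intro x y hxy
    by_cases hx : x = p.castSucc <;> by_cases hy : y = p.castSucc
    · rw [hx, hy]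
    · have := hf (hx ▸ hxy)
      rw [hx, Function.update_self, Function.update_of_ne hy, Fin.le_def]
      rw [Fin.le_def] at this
      dsimp only
      omega
    · have := hlt x (lt_of_le_of_ne (hy ▸ hxy) hx)
      rw [hy, Function.update_self, Function.update_of_ne hx, Fin.le_def]
      rw [Fin.lt_def] at this
      dsimp only
      omega
    · rw [Function.update_of_ne hx, Function.update_of_ne hy]
      exact hf hxy
  · simp only [Nat.dist]
    omega

/-- The order dual of `exists_update_of_lt`: the value at the last point of a fibre is raised by
one. -/
theorem exists_update_of_gt {f : Fin (m + 1) → Fin (m + 1)} (hf : Monotone f)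
    (h : ∃ i, f i < i) : ∃ (p : Fin m) (c : Fin (m + 1)), f p.castSucc = f p.succ ∧
      Monotone (Function.update f p.succ c) ∧
      Nat.dist c p.succ < Nat.dist (f p.succ) p.succ := by
  obtain ⟨i, hi, hmin⟩ := Set.Finite.exists_minimal (toFinite {i | f i < i}) h
  obtain ⟨q, hq, hmax⟩ := Set.Finite.exists_maximal (toFinite {x | f x = f i}) ⟨i, rfl⟩
  have hi : f i < i := hi
  have hq : f q = f i := hq
  have hlt : ∀ x, q < x → f q < f x := fun x hx =>
    lt_of_le_of_ne (hf hx.le) fun he =>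
      hx.not_ge (hmax (show f x = f i from he.symm.trans hq) hx.le)
  have hqi : i ≤ q := by
    by_contra! hlt'
    exact (hlt i hlt').ne hq
  have hqlt : f q < q := hq ▸ hi.trans_le hqi
  obtain ⟨p, rfl⟩ : ∃ p : Fin m, q = p.succ :=
    ⟨q.pred ((Fin.zero_le _).trans_lt hqlt).ne', by simp⟩
  have hps : f p.castSucc = f p.succ := by
    rcases hqi.lt_or_eq with hlt' | rfl
    · exact le_antisymm (hf Fin.castSucc_lt_succ.le)
        (hq ▸ hf (Fin.le_castSucc_iff.2 hlt'))
    · refine le_antisymm (hf Fin.castSucc_lt_succ.le) ?_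
      have h1 : ¬ f p.castSucc < p.castSucc := fun h1 =>
        absurd (hmin h1 Fin.castSucc_lt_succ.le) Fin.castSucc_lt_succ.not_ge
      exact (Fin.le_castSucc_iff.2 hqlt).trans (not_lt.1 h1)
  have hqn : (f p.succ : ℕ) < p.succ := hqlt
  refine ⟨p, ⟨f p.succ + 1, by omega⟩, hps, ?_, ?_⟩
  · intro x y hxy
    by_cases hx : x = p.succ <;> by_cases hy : y = p.succ
    · rw [hx, hy]
    · have := hlt y (lt_of_le_of_ne (hx ▸ hxy) (Ne.symm hy))
      rw [hx, Function.update_self, Function.update_of_ne hy, Fin.le_def]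
      rw [Fin.lt_def] at this
      dsimp only
      omega
    · have := hf (hy ▸ hxy)
      rw [hy, Function.update_self, Function.update_of_ne hx, Fin.le_def]
      rw [Fin.le_def] at this
      dsimp only
      omega
    · rw [Function.update_of_ne hx, Function.update_of_ne hy]
      exact hf hxy
  · simp only [Nat.dist]
    omega

/-- Since `e` sends `p` to `q` first, the value of the second factor at `p` is never used and may be
changed freely. -/
theorem eq_mul_restrictCompl_update {f : Fin (m + 1) →o Fin (m + 1)} {p q c : Fin (m + 1)}
    (hpq : p ≠ q) (hf : f p = f q) (hc : Monotone (Function.update f p c)) {e : PO (m + 1)}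
    (he : ∀ x, (e : PT (m + 1)) x = some (if x = p then q else x)) :
    restrictCompl f ∅ = e * restrictCompl ⟨Function.update f p c, hc⟩ ∅ := by
  refine Subtype.ext (funext fun x => ?_)
  change _ = ((e : PT (m + 1)) x).bind _
  rw [he]
  by_cases hx : x = p
  · simp [restrictCompl, hx, hpq.symm, hf]
  · simp [restrictCompl, hx]

theorem restrictCompl_empty_mem {T : Subsemigroup (PO (m + 1))} (h1 : 1 ∈ T)
    (hT : ∀ k j, topElement (m := m) k j ∈ T) (f : Fin (m + 1) →o Fin (m + 1)) :
    restrictCompl f ∅ ∈ T := by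
  induction hd : displacement f using Nat.strong_induction_on generalizing f with
  | _ d ih =>
    subst hd
    by_cases hup : ∃ i, i < f i
    · obtain ⟨p, c, hp, hc, hdist⟩ := exists_update_of_lt f.monotone hup
      rw [eq_mul_restrictCompl_update Fin.castSucc_lt_succ.ne hp hc
        (topElement_inr_castSucc_apply p)]
      exact T.mul_mem (hT _ _) (ih _ (displacement_update_lt hdist) _ rfl)
    · by_cases hdown : ∃ i, f i < i
      · obtain ⟨p, c, hp, hc, hdist⟩ := exists_update_of_gt f.monotone hdown
        rw [eq_mul_restrictCompl_update Fin.castSucc_lt_succ.ne' hp.symm hc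
          (topElement_inr_succ_apply p)]
        exact T.mul_mem (hT _ _) (ih _ (displacement_update_lt hdist) _ rfl)
      · push Not at hup hdown
        have : restrictCompl f ∅ = 1 := by
          refine Subtype.ext (funext fun x => ?_)
          change (if x ∈ (∅ : Finset _) then none else some (f x)) = some x
          simp [le_antisymm (hup x) (hdown x)]
        rwa [this]

/-- Total maps are products of generators by induction on the displacement; partial ones arise from
them by deleting domain points one at a time. -/
theorem eq_top_of_topElement_mem {T : Subsemigroup (PO (m + 1))} (h1 : 1 ∈ T)
    (hT : ∀ k j, topElement (m := m) k j ∈ T) : T = ⊤ := by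
  refine eq_top_iff.2 fun x _ => ?_
  obtain ⟨f, D, rfl⟩ := exists_eq_restrictCompl x
  induction D using Finset.induction_on with
  | empty => exact restrictCompl_empty_mem h1 hT f
  | insert i D _ ih =>
    rw [restrictCompl_insert]
    exact T.mul_mem (hT _ _) (ih trivial)

theorem isTopClass_topElement (hm : 1 ≤ m) :
    IsTopClass (redundant (m := m)) (topElement (m := m)) where
  inj := topElement_inj
  ne_one k j h := by
    have := rank_topElement k j
    rw [h, show ((1 : PO (m + 1)) : PT (m + 1)) = 1 from rfl, PT.rank_one] at this
    omega
  lower_mul y hx := by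
    rw [mem_lowerPart_iff] at hx ⊢
    exact (PT.rank_mul_le_left _ _).trans_lt hx
  mul_lower y hx := by
    rw [mem_lowerPart_iff] at hx ⊢
    exact (PT.rank_mul_le_right _ _).trans_lt hx
  mul_of_mem := topElement_mul_of_mem
  mul_of_notMem := topElement_mul_of_notMem
  generates _ := eq_top_of_topElement_mem
  single i := ⟨Sum.inl i, rfl⟩
  nonempty := redundant_nonempty
  two k i := by
    obtain ⟨p, hp⟩ : ∃ p : Fin m, i ∈ redundant (Sum.inr p : KernelType m) := by
      rcases Fin.eq_zero_or_eq_succ i with rfl | ⟨p, rfl⟩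
      · exact ⟨⟨0, hm⟩, Or.inl rfl⟩
      · exact ⟨p, Or.inr rfl⟩
    rcases k with j | q
    · exact ⟨Sum.inr p, by simp, hp⟩
    · exact ⟨Sum.inl i, by simp, rfl⟩

/-! The sets `J`, `L`, `R` and `RPair` -/

theorem inPO_J : inPO (PT.J (m + 1)) = {x | ∃ k i, x = topElement (m := m) k i} := by
  ext x
  constructor
  · exact exists_eq_topElement
  · rintro ⟨k, i, rfl⟩
    exact rank_topElement k i

theorem topElement_mem_J (k : KernelType m) (j : Fin (m + 1)) :
    (topElement k j : PT (m + 1)) ∈ PT.J (m + 1) := rank_topElement k j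

theorem topElement_mem_L_iff {k : KernelType m} {i j : Fin (m + 1)} :
    topElement k j ∈ inPO (PT.L i) ↔ j = i := by
  constructor
  · rintro ⟨-, h⟩
    rw [im_topElement] at h
    exact (of_not_not h : i = j).symm
  · rintro rfl
    refine ⟨topElement_mem_J k j, ?_⟩
    simp [im_topElement]

theorem topElement_mem_R_iff {k : KernelType m} {i j : Fin (m + 1)} :
    topElement k j ∈ inPO (PT.R i) ↔ k = Sum.inl i := by
  have hdom : i ∉ PT.dom (topElement k j : PT (m + 1)) ↔ proj k i = none := by
    change (¬ ∃ y, Option.map _ _ = some y) ↔ _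
    cases proj k i <;> simp
  constructor
  · rintro ⟨-, h⟩
    rcases k with a | p
    · rw [finSuccEquiv'_eq_none.1 (hdom.1 h)]
    · cases hdom.1 h
  · rintro rfl
    exact ⟨topElement_mem_J _ j, hdom.2 (finSuccEquiv'_at i)⟩

theorem topElement_mem_RPair_iff {k : KernelType m} {p : Fin m} {j : Fin (m + 1)} :
    topElement k j ∈ inPO (PT.RPair p.castSucc p.succ) ↔ k = Sum.inr p := by
  constructor
  · rintro ⟨-, ⟨y, hy⟩, -, h⟩
    have h : (topElement k j : PT (m + 1)) p.castSucc = (topElement k j : PT (m + 1)) p.succ := h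
    rw [topElement_apply] at hy
    obtain ⟨v, hv, -⟩ := Option.map_eq_some_iff.1 hy
    have hv' : proj k p.succ = some v := by
      rw [← hv]
      exact (Option.map_injective (Fin.succAbove_right_injective (p := j)) h).symm
    rcases k with i | q
    · have := (finSuccEquiv' i).injective (hv.trans hv'.symm)
      exact absurd this Fin.castSucc_lt_succ.ne
    -- Two distinct points with the same value are both redundant, and the redundant pair determines
    -- `q`.
    · have hmem : ∀ a b : Fin (m + 1), a ≠ b → proj (Sum.inr q) a = some v →
          proj (Sum.inr q) b = some v → a ∈ redundant (Sum.inr q : KernelType m) := by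
        intro a b hab ha hb
        by_contra hn
        obtain ⟨w, hw, hu⟩ := proj_of_notMem hn
        exact hab (hu b (hb.trans (ha.symm.trans hw))).symm
      have h1 := hmem _ _ Fin.castSucc_lt_succ.ne hv hv'
      have h2 := hmem _ _ Fin.castSucc_lt_succ.ne' hv' hv
      simp only [redundant, mem_insert_iff, mem_singleton_iff, Fin.ext_iff, Fin.val_castSucc,
        Fin.val_succ] at h1 h2
      have : p = q := by
        ext
        omega
      rw [this]
  · rintro rfl
    refine ⟨topElement_mem_J _ j, ⟨_, rfl⟩, ⟨_, rfl⟩, ?_⟩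
    change some (j.succAbove (p.predAbove p.castSucc)) = some (j.succAbove (p.predAbove p.succ))
    rw [Fin.predAbove_castSucc_self, Fin.predAbove_succ_self]

theorem rectangleSet_eq (hm : 1 ≤ m) (A : Set (Fin (m + 1))) :
    rectangleSet (m + 1) A = ((isTopClass_topElement hm).rectCompl A : Set (PO (m + 1))) := by
  have h := isTopClass_topElement hm
  ext x
  by_cases hx : ∃ k j, x = topElement (m := m) k j
  swap
  · constructor
    · rintro - ⟨k, j, hkj, -⟩
      exact hx ⟨k, j, hkj⟩
    · intro _
      refine Or.inl ?_
      rw [inPO_J]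
      exact hx
  obtain ⟨k, j, rfl⟩ := hx
  have hJ : topElement k j ∈ inPO (PT.J (m + 1)) := topElement_mem_J k j
  have h1 : topElement k j ∈ ((isTopClass_topElement hm).rectCompl A : Set (PO (m + 1))) ↔
      (j ∈ A ∨ ∀ a ∈ redundant k, a ∉ A) := by
    rw [SetLike.mem_coe, ← not_iff_not, h.delta_notMem_rectCompl]
    push Not
    rfl
  have h2 : (∃ (i i' : Fin (m + 1)) (_ : (i : ℕ) + 1 = i') (_ : i ∉ A ∧ i' ∉ A),
      topElement k j ∈ inPO (PT.RPair i i')) ↔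
      ∃ p : Fin m, (p.castSucc ∉ A ∧ p.succ ∉ A) ∧ k = Sum.inr p := by
    constructor
    · rintro ⟨i, i', hii, hA, hmem⟩
      obtain ⟨p, rfl⟩ : ∃ p : Fin m, i = p.castSucc := ⟨⟨i, by omega⟩, rfl⟩
      obtain rfl : i' = p.succ := Fin.ext hii.symm
      exact ⟨p, hA, topElement_mem_RPair_iff.1 hmem⟩
    · rintro ⟨p, hA, hk⟩
      exact ⟨p.castSucc, p.succ, by simp, hA, topElement_mem_RPair_iff.2 hk⟩
  rw [h1]
  simp only [rectangleSet, mem_union, mem_compl_iff, hJ, not_true, false_or, mem_iUnion,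
    exists_prop, topElement_mem_L_iff, topElement_mem_R_iff]
  simp only [exists_prop] at h2
  rw [h2]
  rcases k with i | p
  · simp [redundant]
  · simp [redundant]

end Rank

/-! ### Degree one -/

section DegreeOne

/-- The empty partial transformation of degree `1`. -/
def emptyPO : PO 1 := ⟨fun _ => none, fun _ _ _ _ _ ha => by cases ha⟩

theorem PO_one_eq_top : PO 1 = ⊤ :=
  eq_top_iff.2 fun _ _ _ _ a b _ _ _ => (Subsingleton.elim a b).le

theorem eq_one_or_eq_emptyPO (x : PO 1) : x = 1 ∨ x = emptyPO := by
  cases hx : (x : PT 1) 0 with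
  | none =>
    refine Or.inr (Subtype.ext (funext fun i => ?_))
    rw [Subsingleton.elim i 0, hx]
    rfl
  | some y =>
    refine Or.inl (Subtype.ext (funext fun i => ?_))
    rw [Subsingleton.elim i 0, hx, Subsingleton.elim y 0]
    rfl

theorem one_ne_emptyPO : (1 : PO 1) ≠ emptyPO := fun h => by
  have := congrFun (congrArg Subtype.val h) 0
  cases this

theorem PO_one_mul_comm (x y : PO 1) : x * y = y * x := by
  rcases eq_one_or_eq_emptyPO x with rfl | rfl <;> rcases eq_one_or_eq_emptyPO y with rfl | rfl <;>
    simp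

theorem PO_one_mul_self (x : PO 1) : x * x = x := by
  rcases eq_one_or_eq_emptyPO x with rfl | rfl
  · simp
  · rfl

theorem card_PO_one : Nat.card (PO 1) = 2 := by
  have : (univ : Set (PO 1)) = {1, emptyPO} := by
    ext x
    simpa using eq_one_or_eq_emptyPO x
  rw [← ncard_univ, this, ncard_pair one_ne_emptyPO]

theorem setOf_isMaximalSubsemigroup_PO_one :
    {M : Set (PO 1) | IsMaximalSubsemigroup M} = {M | ∃ x : PO 1, M = {x}} := by
  have single : ∀ x : PO 1, ∃ N : Subsemigroup (PO 1), (N : Set (PO 1)) = {x} := fun x =>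
    ⟨⟨{x}, by rintro _ _ rfl rfl; exact PO_one_mul_self _⟩, rfl⟩
  have two : ∀ x y z : PO 1, x ≠ y → z = x ∨ z = y := by
    intro x y z hxy
    rcases eq_one_or_eq_emptyPO x with rfl | rfl <;>
      rcases eq_one_or_eq_emptyPO y with rfl | rfl
    · exact absurd rfl hxy
    · exact eq_one_or_eq_emptyPO z
    · exact (eq_one_or_eq_emptyPO z).symm
    · exact absurd rfl hxy
  ext M
  constructor
  · rintro ⟨N, rfl, hN⟩
    -- The empty set counts as a subsemigroup; it is not maximal because {1} lies strictly between
    -- it and the whole monoid.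
    have hne : N ≠ ⊥ := by
      rintro rfl
      obtain ⟨P, hP⟩ := single 1
      have hmem : (1 : PO 1) ∈ P := by rw [← SetLike.mem_coe, hP]; rfl
      have hbot : P ≠ ⊥ := by
        rintro rfl
        exact Subsemigroup.notMem_bot hmem
      have htop := hN.2 P (bot_lt_iff_ne_bot.2 hbot)
      have : emptyPO ∈ (P : Set (PO 1)) := by rw [htop]; trivial
      rw [hP] at this
      exact one_ne_emptyPO this.symm
    obtain ⟨x, hx⟩ : ∃ x, x ∈ N := by
      by_contra! h
      exact hne (eq_bot_iff.2 fun x hx => absurd hx (h x))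
    refine ⟨x, Subset.antisymm (fun y hy => ?_) (by simpa using hx)⟩
    by_contra hyx
    refine hN.1 (eq_top_iff.2 fun z _ => ?_)
    rcases two x y z (Ne.symm hyx) with rfl | rfl
    · exact hx
    · exact hy
  · rintro ⟨x, rfl⟩
    obtain ⟨N, hN⟩ := single x
    refine ⟨N, hN, ?_, fun P hP => ?_⟩
    · rintro rfl
      have h1 : (1 : PO 1) ∈ ({x} : Set (PO 1)) := by rw [← hN]; trivial
      have h2 : emptyPO ∈ ({x} : Set (PO 1)) := by rw [← hN]; trivial
      exact one_ne_emptyPO (h1.trans (h2 : emptyPO = x).symm)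
    · obtain ⟨y, hy, hyN⟩ := SetLike.exists_of_lt hP
      have hx : x ∈ N := by rw [← SetLike.mem_coe, hN]; rfl
      refine eq_top_iff.2 fun z _ => ?_
      rcases two x y z (fun h => hyN (h ▸ hx)) with rfl | rfl
      · exact hP.le hx
      · exact hy

end DegreeOne

/-! ### The classification for degree at least two, and the final statement -/

theorem setOf_isMaximalSubsemigroup_PO {m : ℕ} (hm : 1 ≤ m) :
    {M : Set (PO (m + 1)) | IsMaximalSubsemigroup M} =
      {({1} : Set (PO (m + 1)))ᶜ} ∪
      {M | ∃ A : Set (Fin (m + 1)), A.Nonempty ∧ A ≠ Set.univ ∧ M = rectangleSet (m + 1) A} ∪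
      {M | ∃ R : Set (PO (m + 1)), IsGreenRClass R ∧ R ⊆ inPO (PT.J (m + 1)) ∧ M = Rᶜ} := by
  have h := isTopClass_topElement hm
  rw [h.setOf_isMaximalSubsemigroup]
  ext M
  constructor
  · rintro ⟨_ | k | A, rfl⟩
    · exact Or.inl (Or.inl rfl)
    · obtain ⟨h1, h2⟩ := h.isGreenRClass_subset_iff.2 ⟨k, rfl⟩
      exact Or.inr ⟨_, h1, inPO_J (m := m) ▸ h2, rfl⟩
    · exact Or.inl (Or.inr ⟨A, A.2.1, A.2.2, (rectangleSet_eq hm A).symm⟩)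
  · rintro ((rfl | ⟨A, hA, hA', rfl⟩) | ⟨R, hR, hRJ, rfl⟩)
    · exact ⟨none, rfl⟩
    · exact ⟨some (Sum.inr ⟨A, hA, hA'⟩), (rectangleSet_eq hm A).symm⟩
    · rw [inPO_J] at hRJ
      obtain ⟨k, rfl⟩ := h.isGreenRClass_subset_iff.1 ⟨hR, hRJ⟩
      exact ⟨some (Sum.inl k), rfl⟩

theorem mainTheorem6 :
    (∀ n : ℕ, 2 ≤ n →
      {M : Set (PO n) | IsMaximalSubsemigroup M} =
          {({1} : Set (PO n))ᶜ} ∪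
          {M | ∃ A : Set (Fin n), A.Nonempty ∧ A ≠ Set.univ ∧ M = rectangleSet n A} ∪
          {M | ∃ R : Set (PO n), IsGreenRClass R ∧ R ⊆ inPO (PT.J n) ∧ M = Rᶜ} ∧
      MaximalOfTypeM1 ({1} : Set (PO n)) ({1} : Set (PO n))ᶜ ∧
      (∀ A : Set (Fin n), A.Nonempty → A ≠ Set.univ →
        MaximalOfTypeM2 (inPO (PT.J n)) (rectangleSet n A)) ∧
      (∀ R : Set (PO n), IsGreenRClass R → R ⊆ inPO (PT.J n) →
        MaximalOfTypeM4 (inPO (PT.J n)) Rᶜ)) ∧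
    (PO 1 = ⊤ ∧ Nat.card (PO 1) = 2 ∧
      (∀ x y : PO 1, x * y = y * x) ∧ (∀ x : PO 1, x * x = x) ∧
      {M : Set (PO 1) | IsMaximalSubsemigroup M} = {M | ∃ x : PO 1, M = {x}}) ∧
    (∀ n : ℕ, 1 ≤ n →
      {M : Set (PO n) | IsMaximalSubsemigroup M}.ncard = 2 ^ n + 2 * n - 2) := by

  refine ⟨fun n hn => ?_, ⟨PO_one_eq_top, card_PO_one, PO_one_mul_comm, PO_one_mul_self,
    setOf_isMaximalSubsemigroup_PO_one⟩, fun n hn => ?_⟩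
  · obtain ⟨m, rfl⟩ : ∃ m, n = m + 1 := ⟨n - 1, by omega⟩
    have hm : 1 ≤ m := by omega
    have h := isTopClass_topElement hm
    refine ⟨setOf_isMaximalSubsemigroup_PO hm, h.maximalOfTypeM1, fun A hA hA' => ?_,
      fun R hR hRJ => ?_⟩
    · rw [rectangleSet_eq hm, inPO_J]
      exact h.maximalOfTypeM2 hA hA'
    · rw [inPO_J] at hRJ ⊢
      obtain ⟨k, rfl⟩ := h.isGreenRClass_subset_iff.1 ⟨hR, hRJ⟩
      exact h.maximalOfTypeM4 k
  · obtain ⟨m, rfl⟩ : ∃ m, n = m + 1 := ⟨n - 1, by omega⟩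
    rcases Nat.eq_zero_or_pos m with rfl | hm
    · have : {M : Set (PO 1) | ∃ x : PO 1, M = {x}} = (fun x => {x}) '' univ := by
        ext M
        simp [eq_comm]
      change {M : Set (PO 1) | IsMaximalSubsemigroup M}.ncard = 2
      rw [setOf_isMaximalSubsemigroup_PO_one, this,
        ncard_image_of_injective _ singleton_injective, ncard_univ, card_PO_one]
    · rw [(isTopClass_topElement hm).ncard_maximal, Nat.card_fin, Nat.card_sum, Nat.card_fin,
        Nat.card_fin]
      have : 0 < 2 ^ (m + 1) := by positivity
      omega
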